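/- **Theorem 3.** For window weights $h=(h_1,\dots,h_N)\in\mathbb{C}^N$ with $\sum_n|h_n|^2=1$ and at least two nonzero $h_n$, let $\mathbf{x}(\omega)\in\mathbb{C}^N$, $\omega\in\mathbb{R}$, be the windowed sinusoid with entries $x_n(\omega)=h_n e^{j\omega(n-(N+1)/2)}$, $n=1,\dots,N$, and let $\tau=1/\Vert \mathbf{x}'(\omega)\Vert$, which does not depend on $\omega$ (all vector norms are Euclidean). For $\boldsymbol{\omega}=(\omega_1,\dots,\omega_K)\in\mathbb{R}^K$, $K\ge 1$, let $$\mathbf{T}(\boldsymbol{\omega})=\left[\mathbf{x}(\omega_1)\ \cdots\ \mathbf{x}(\omega_K)\ \ \tau\mathbf{x}'(\omega_1)\ \cdots\ \tau\mathbf{x}'(\omega_K)\right]\in\mathbb{C}^{N\times 2K},$$ and for $\delta>0$ let $\Lambda_T(\delta)$ be the set of all $\boldsymbol{\omega}\in\mathbb{R}^K$ for which the smallest singular value $\min_{\mathbf{q}\in\mathbb{C}^{2K}\setminus\{\mathbf 0\}}\Vert\mathbf{T}(\boldsymbol{\omega})\mathbf{q}\Vert/\Vert\mathbf{q}\Vert$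 of $\mathbf{T}(\boldsymbol{\omega})$ is at least $\delta$. There are absolute constants $C,c>0$ such that the following holds for all $N,K,M\ge 1$, all $h$ as above, all $\epsilon>0$ and all $\delta>0$. Let $\mathbf{A}$ be a random $M\times N$ matrix whose entries are i.i.d. uniform on $\{\pm1/\sqrt N,\pm j/\sqrt N\}$. If $$M\ \ge\ C\,\epsilon^{-2}K\log\left(NK\epsilon^{-1}\delta^{-1}\right),$$ then, except on an event of probability at most $e^{-c\,\epsilon^2M}$, $$1-\epsilon\ \le\ \sqrt{\frac NM}\,\frac{\Vert\mathbf{A}\mathbf{T}(\boldsymbol{\omega})\mathbf{q}\Vert}{\Vert\mathbf{T}(\boldsymbol{\omega})\mathbf{q}\Vert}\ \le\ 1+\epsilon\qquad\text{for all }\boldsymbol{\omega}\in\Lambda_T(\delta)\text{ and all }\mathbf{q}\in\mathbb{C}^{2K}\setminus\{\mathbf 0\}.$$ -/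

import Mathlib

open MeasureTheory ProbabilityTheory
open scoped Matrix

noncomputable section

namespace SinusoidMixture

/-- The Euclidean norm of a complex vector. -/
def l2norm {ι : Type*} [Fintype ι] (v : ι → ℂ) : ℝ :=
  ‖(WithLp.toLp 2 v : EuclideanSpace ℂ ι)‖

/-- The windowed sinusoid of frequency `ω` with window weights `h`. With the 0-based index `n` the
entries are `h n * exp (j ω (n - (N - 1) / 2))`, so the exponents run from `-jω(N-1)/2` up to
`jω(N-1)/2`. -/
def sinusoid {N : ℕ} (h : Fin N → ℂ) (ω : ℝ) : Fin N → ℂ := fun n =>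
  h n * Complex.exp (Complex.I * (ω : ℂ) * (((n : ℕ) : ℂ) - ((N : ℂ) - 1) / 2))

/-- The normalization `τ = 1 / ‖dx(ω)/dω‖` of the derivative (its value is the same at all `ω`). -/
def tau {N : ℕ} (h : Fin N → ℂ) (ω : ℝ) : ℝ :=
  1 / l2norm (deriv (sinusoid h) ω)

/-- The tangent plane matrix `[x(ω₁) ⋯ x(ω_K)  τ x'(ω₁) ⋯ τ x'(ω_K)]`, of size `N × 2K`. -/
def tangentMatrix {N K : ℕ} (h : Fin N → ℂ) (ω : Fin K → ℝ) :
    Matrix (Fin N) (Fin K ⊕ Fin K) ℂ :=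
  Matrix.of fun n => Sum.elim
    (fun l => sinusoid h (ω l) n)
    (fun l => (tau h (ω l) : ℂ) * deriv (sinusoid h) (ω l) n)

/-- The smallest singular value `min_{q ≠ 0} ‖T q‖ / ‖q‖` of a matrix `T`. -/
def smallestSingularValue {m n : Type*} [Fintype m] [Fintype n] (T : Matrix m n ℂ) : ℝ :=
  ⨅ q : {q : n → ℂ // q ≠ 0}, l2norm (T *ᵥ q.1) / l2norm q.1

/-- The set `Λ_T(δ)` of the frequency tuples whose tangent plane matrix has smallest singular value
at least `δ`. -/
def wellConditioned {N : ℕ} (h : Fin N → ℂ) (K : ℕ) (δ : ℝ) : Set (Fin K → ℝ) :=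
  {ω | δ ≤ smallestSingularValue (tangentMatrix h ω)}

/-- `A` is an `ε`-isometry, up to the scale `√(M/N)`, on the column span of the matrix `T`. -/
def IsIsometryOnSpan {M N : ℕ} {n : Type*} [Fintype n] (ε : ℝ)
    (A : Matrix (Fin M) (Fin N) ℂ) (T : Matrix (Fin N) n ℂ) : Prop :=
  ∀ q : n → ℂ, T *ᵥ q ≠ 0 →
    1 - ε ≤ √((N : ℝ) / M) * (l2norm (A *ᵥ (T *ᵥ q)) / l2norm (T *ᵥ q)) ∧
      √((N : ℝ) / M) * (l2norm (A *ᵥ (T *ᵥ q)) / l2norm (T *ᵥ q)) ≤ 1 + ε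

/-- The four values `±1/√N`, `±j/√N` of the projection weights. -/
def weightValues (N : ℕ) : Set ℂ :=
  {1 / (√(N : ℝ) : ℂ), -(1 / (√(N : ℝ) : ℂ)),
    Complex.I / (√(N : ℝ) : ℂ), -(Complex.I / (√(N : ℝ) : ℂ))}

/-- The entries of the random matrix `A` are independent and each is uniformly distributed on
`{±1/√N, ±j/√N}`. -/
structure IsUniformMeasurementMatrix {Ω : Type*} [MeasurableSpace Ω] (P : Measure Ω) {M N : ℕ}
    (A : Ω → Matrix (Fin M) (Fin N) ℂ) : Prop where
  hasLaw : ∀ i j, HasLaw (fun w => A w i j) (uniformOn (weightValues N)) P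
  indep : iIndepFun (fun (p : Fin M × Fin N) (w : Ω) => A w p.1 p.2) P

end SinusoidMixture

end

/-! The proof is a union bound over a grid. For one fixed vector `y` of norm 1, the real and
imaginary parts of each measurement, scaled by `√N`, are sums of independent bounded centred
variables, hence sub-Gaussian. The energy `rowEnergy` is therefore centred with exponential moments,
and Bernstein's inequality over the `M` rows gives failure probability `2 exp(-t²M/4096)`
(`measureReal_isometry_failure_le`).

To treat all `ω` and `q` at once, normalize `‖Tq‖ = 1`. Good conditioning gives `‖q‖ ≤ 1/δ`, and `T`
is `4π`-periodic in each frequency, so `Tq` is determined by `5K` real parameters in a bounded box: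
`K` frequencies and `2K` complex coefficients. The dependence on them is Lipschitz
(`l2norm_synthesis_sub_le`), and the deterministic bound `√(N/M) ‖Av‖ ≤ √N ‖v‖` carries
near-isometry from a sufficiently fine grid to every such vector (`isIsometryOnSpan_of_grid`). With
`L = NK/(εδ)` the grid has at most `L^(110K)` points, and half of the Bernstein exponent pays for
them (`card_mul_exp_le`). -/

noncomputable section

namespace SinusoidMixture

/-! ### Sub-Gaussian squares and Bernstein's inequality -/

section Tail

variable {Ω : Type*} [MeasurableSpace Ω] {μ : Measure Ω}

theorem lintegral_gaussianReal_exp_sq_div_four :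
    ∫⁻ g, ENNReal.ofReal (Real.exp (g ^ 2 / 4)) ∂(gaussianReal 0 1) = ENNReal.ofReal (√2) := by
  rw [gaussianReal_of_var_ne_zero _ one_ne_zero,
    lintegral_withDensity_eq_lintegral_mul _ (measurable_gaussianPDF 0 1) (by fun_prop)]
  have hint : Integrable fun x : ℝ => (√(2 * Real.pi))⁻¹ * Real.exp (-(1 / 4) * x ^ 2) :=
    (integrable_exp_neg_mul_sq (by norm_num : (0 : ℝ) < 1 / 4)).const_mul _
  have hpt : ∀ x : ℝ, (gaussianPDF 0 1 * fun g => ENNReal.ofReal (Real.exp (g ^ 2 / 4))) x =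
      ENNReal.ofReal ((√(2 * Real.pi))⁻¹ * Real.exp (-(1 / 4) * x ^ 2)) := by
    intro x
    rw [Pi.mul_apply, gaussianPDF, ← ENNReal.ofReal_mul (gaussianPDFReal_nonneg _ _ _),
      gaussianPDFReal, mul_assoc, ← Real.exp_add]
    congr 3
    · simp
    · simp only [NNReal.coe_one]; ring
  simp_rw [hpt]
  rw [← ofReal_integral_eq_lintegral_ofReal hint (.of_forall fun x => by positivity),
    integral_const_mul, integral_gaussian]
  congr 1
  rw [← Real.sqrt_inv, ← Real.sqrt_mul (by positivity)]
  congr 1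
  have := Real.pi_ne_zero
  field_simp
  norm_num

/-- The square of a `1`-sub-Gaussian variable has exponential moments. -/
theorem lintegral_exp_sq_div_four_le [IsProbabilityMeasure μ] {X : Ω → ℝ}
    (hX : HasSubgaussianMGF X 1 μ) :
    ∫⁻ w, ENNReal.ofReal (Real.exp (X w ^ 2 / 4)) ∂μ ≤ ENNReal.ofReal (√2) := by
  have hs : (√(1 / 2 : ℝ)) ^ 2 = 1 / 2 := Real.sq_sqrt (by norm_num)
  -- An auxiliary Gaussian `g` linearizes the square. After exchanging integrals, the sub-Gaussian
  -- bound replaces `X` by a second standard Gaussian at the level of moment generating functions.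
  have h1 : ∀ x : ℝ, ENNReal.ofReal (Real.exp (x ^ 2 / 4)) =
      ∫⁻ g, ENNReal.ofReal (Real.exp (√(1 / 2) * x * g)) ∂(gaussianReal 0 1) := by
    intro x
    rw [← ofReal_integral_eq_lintegral_ofReal (integrable_exp_mul_gaussianReal _)
      (.of_forall fun x => by positivity)]
    have := congrFun (mgf_id_gaussianReal (μ := 0) (v := 1)) (√(1 / 2) * x)
    simp only [mgf, id] at this
    rw [this]
    congr 2
    simp only [NNReal.coe_one, mul_pow, hs]
    ring
  simp_rw [h1]
  have hm := hX.aemeasurable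
  rw [lintegral_lintegral_swap]
  · rw [← lintegral_gaussianReal_exp_sq_div_four]
    refine lintegral_mono fun g => ?_
    have h2 : ∀ w, √(1 / 2) * X w * g = (√(1 / 2) * g) * X w := fun w => by ring
    simp_rw [h2]
    rw [← ofReal_integral_eq_lintegral_ofReal (hX.integrable_exp_mul _)
      (.of_forall fun x => by positivity)]
    refine ENNReal.ofReal_le_ofReal ((hX.mgf_le _).trans (le_of_eq ?_))
    simp only [NNReal.coe_one, mul_pow, hs]
    congr 1
    ring
  · have : AEMeasurable (fun p : Ω × ℝ => X p.1) (μ.prod (gaussianReal 0 1)) :=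
      hm.comp_fst
    simp only [Function.uncurry_def]
    fun_prop

theorem exp_le_one_add_add_sq_mul_exp_abs (x : ℝ) :
    Real.exp x ≤ 1 + x + x ^ 2 * Real.exp |x| := by
  have h := Complex.norm_exp_sub_sum_le_norm_mul_exp (x : ℂ) 2
  have h2 : Complex.exp x - ∑ m ∈ Finset.range 2, (x : ℂ) ^ m / m.factorial =
      ((Real.exp x - (1 + x) : ℝ) : ℂ) := by
    simp [Finset.sum_range_succ]
  rw [h2, Complex.norm_real, Complex.norm_real, Real.norm_eq_abs, Real.norm_eq_abs, sq_abs] at h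
  linarith [le_abs_self (Real.exp x - (1 + x))]

/-- A centred variable with a bounded exponential moment has a locally Gaussian moment generating
function. -/
theorem mgf_le_of_integral_exp_abs_le [IsProbabilityMeasure μ] {W : Ω → ℝ}
    (hWm : AEMeasurable W μ) (hint : Integrable (fun w => Real.exp (|W w| / 8)) μ)
    (hle : ∫ w, Real.exp (|W w| / 8) ∂μ ≤ 2) (hW : ∫ w, W w ∂μ = 0) {s : ℝ} (hs : |s| ≤ 1 / 16) :
    Integrable (fun w => Real.exp (s * W w)) μ ∧ mgf W μ s ≤ Real.exp (1024 * s ^ 2) := by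
  have hI : Integrable (fun w => Real.exp (s * W w)) μ := by
    refine hint.mono' (by fun_prop) (.of_forall fun w => ?_)
    rw [Real.norm_eq_abs, abs_of_pos (Real.exp_pos _), Real.exp_le_exp]
    have := le_abs_self (s * W w)
    rw [abs_mul] at this
    nlinarith [abs_nonneg (W w)]
  have hIW : Integrable W μ := by
    refine (hint.const_mul 8).mono' hWm.aestronglyMeasurable (.of_forall fun w => ?_)
    rw [Real.norm_eq_abs]
    linarith [Real.add_one_le_exp (|W w| / 8)]
  refine ⟨hI, ?_⟩
  have hpt : ∀ w, Real.exp (s * W w) ≤ 1 + s * W w + 512 * s ^ 2 * Real.exp (|W w| / 8) := by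
    intro w
    have h1 := exp_le_one_add_add_sq_mul_exp_abs (s * W w)
    have h2 : |s * W w| ≤ |W w| / 16 := by
      rw [abs_mul]; nlinarith [abs_nonneg (W w)]
    -- The exponent `|W|/8` is split in two: one half absorbs `W²` (from `x²/2 ≤ exp x` at `x =
    -- |W|/16`, whence 512), the other absorbs `exp |sW|`.
    have h3 : W w ^ 2 ≤ 512 * Real.exp (|W w| / 16) := by
      have h4 := Real.quadratic_le_exp_of_nonneg (x := |W w| / 16) (by positivity)
      have h5 := sq_abs (W w)
      nlinarith [abs_nonneg (W w)]
    have h6 : Real.exp (|W w| / 8) = Real.exp (|W w| / 16) * Real.exp (|W w| / 16) := by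
      rw [← Real.exp_add]; congr 1; ring
    have h7 := Real.exp_le_exp.mpr h2
    have h8 : (s * W w) ^ 2 * Real.exp |s * W w| ≤
        s ^ 2 * (512 * Real.exp (|W w| / 16)) * Real.exp (|W w| / 16) := by
      rw [mul_pow]
      gcongr
    rw [h6]
    linarith
  have h := integral_mono hI (((integrable_const 1).add (hIW.const_mul s)).add
    (hint.const_mul (512 * s ^ 2))) hpt
  have h' : ∫ w, (1 + s * W w + 512 * s ^ 2 * Real.exp (|W w| / 8)) ∂μ =
      1 + 512 * s ^ 2 * ∫ w, Real.exp (|W w| / 8) ∂μ := by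
    rw [integral_add (f := fun w => 1 + s * W w) ((integrable_const 1).add (hIW.const_mul s))
      (hint.const_mul _), integral_add (integrable_const 1) (hIW.const_mul s),
      integral_const_mul, integral_const_mul, hW]
    simp
  replace h := h.trans_eq h'
  have h9 := Real.add_one_le_exp (1024 * s ^ 2)
  have h10 : mgf W μ s ≤ 1 + 1024 * s ^ 2 := by
    refine h.trans ?_
    nlinarith [sq_nonneg s]
  linarith

/-- Bernstein's inequality, upper tail. -/
theorem measureReal_sum_ge_le {M : ℕ} {W : Fin M → Ω → ℝ} (hW : iIndepFun W μ)
    (hWm : ∀ m, Measurable (W m))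
    (h : ∀ m, ∀ s : ℝ, |s| ≤ 1 / 16 → Integrable (fun w => Real.exp (s * W m w)) μ ∧
      mgf (W m) μ s ≤ Real.exp (1024 * s ^ 2)) {t u : ℝ} (ht : 0 ≤ t)
    (hut : u ≤ t) (hut2 : u ≤ t ^ 2) :
    μ.real {w | t * M ≤ ∑ m, W m w} ≤ Real.exp (-(u * M / 4096)) := by
  have : IsProbabilityMeasure μ := hW.isProbabilityMeasure
  -- `t/2048` maximizes `s t - 1024 s²`; the cap at `t = 1` keeps `s` in the range where the moment
  -- bound holds.
  set s : ℝ := min t 1 / 2048 with hsdef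
  have hm0 : 0 ≤ min t 1 := le_min ht zero_le_one
  have hm1 : min t 1 ≤ 1 := min_le_right _ _
  have hs0 : 0 ≤ s := by positivity
  have hs1 : |s| ≤ 1 / 16 := by rw [abs_of_nonneg hs0, hsdef]; linarith
  have hint : Integrable (fun w => Real.exp (s * (∑ m, W m) w)) μ :=
    hW.integrable_exp_mul_sum hWm fun m _ => (h m s hs1).1
  have h1 := measure_ge_le_exp_mul_mgf (t * M) hs0 hint
  rw [hW.mgf_sum hWm] at h1
  have h2 : ∏ m, mgf (W m) μ s ≤ ∏ _m : Fin M, Real.exp (1024 * s ^ 2) :=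
    Finset.prod_le_prod (fun _ _ => mgf_nonneg) fun m _ => (h m s hs1).2
  rw [Finset.prod_const, Finset.card_univ, Fintype.card_fin, ← Real.exp_nat_mul] at h2
  have hkey : u / 4096 ≤ s * t - 1024 * s ^ 2 := by
    rw [hsdef]
    rcases le_total t 1 with h' | h'
    · rw [min_eq_left h']; nlinarith
    · rw [min_eq_right h']; nlinarith
  simp only [Finset.sum_apply] at h1
  calc _ ≤ _ := h1
    _ ≤ Real.exp (-s * (t * M)) * Real.exp (M * (1024 * s ^ 2)) := by gcongr
    _ = Real.exp (-((s * t - 1024 * s ^ 2) * M)) := by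
      rw [← Real.exp_add]; congr 1; ring
    _ ≤ _ := by
      apply Real.exp_le_exp.mpr
      have : u / 4096 * M ≤ (s * t - 1024 * s ^ 2) * M := by gcongr
      linarith

end Tail

/-! ### The four-point law of the weights -/

section WeightLaw

theorem sqrt_natCast_ne_zero {N : ℕ} (hN : 0 < N) : ((√(N : ℝ) : ℝ) : ℂ) ≠ 0 := by
  simp [hN.ne']

open Classical in
theorem weightValues_eq_coe (N : ℕ) : weightValues N =
    (({1 / (√(N : ℝ) : ℂ), -(1 / (√(N : ℝ) : ℂ)),
      Complex.I / (√(N : ℝ) : ℂ), -(Complex.I / (√(N : ℝ) : ℂ))} : Finset ℂ) : Set ℂ) := by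
  simp [weightValues]

theorem finite_weightValues (N : ℕ) : (weightValues N).Finite := by
  rw [weightValues_eq_coe]; exact Finset.finite_toSet _

instance isProbabilityMeasure_uniformOn_weightValues (N : ℕ) :
    IsProbabilityMeasure (uniformOn (weightValues N)) :=
  isProbabilityMeasure_uniformOn (finite_weightValues N) ⟨_, Set.mem_insert _ _⟩

theorem ae_mem_weightValues (N : ℕ) : ∀ᵐ z ∂(uniformOn (weightValues N)), z ∈ weightValues N := by
  have h := uniformOn_self (finite_weightValues N) ⟨_, Set.mem_insert _ _⟩
  exact (prob_compl_eq_zero_iff (finite_weightValues N).measurableSet).mpr h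

theorem norm_of_mem_weightValues {N : ℕ} {z : ℂ} (hz : z ∈ weightValues N) :
    ‖z‖ = 1 / √(N : ℝ) := by
  rcases hz with rfl | rfl | rfl | rfl <;>
    simp [abs_of_nonneg (Real.sqrt_nonneg _)]

theorem integral_uniformOn_weightValues {N : ℕ} (hN : 0 < N) (f : ℂ → ℝ) :
    ∫ z, f z ∂(uniformOn (weightValues N)) =
      (f (1 / (√(N : ℝ) : ℂ)) + f (-(1 / (√(N : ℝ) : ℂ))) + f (Complex.I / (√(N : ℝ) : ℂ)) +
        f (-(Complex.I / (√(N : ℝ) : ℂ)))) / 4 := by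
  classical
  have h0 := sqrt_natCast_ne_zero hN
  set r : ℂ := (√(N : ℝ) : ℂ)
  have h1 : (1 / r) ∉ ({-(1 / r), Complex.I / r, -(Complex.I / r)} : Finset ℂ) := by
    simp only [Finset.mem_insert, Finset.mem_singleton, not_or]
    field_simp
    norm_num [Complex.ext_iff]
  have h2 : -(1 / r) ∉ ({Complex.I / r, -(Complex.I / r)} : Finset ℂ) := by
    simp only [Finset.mem_insert, Finset.mem_singleton, not_or]
    field_simp
    norm_num [Complex.ext_iff]
  have h3 : Complex.I / r ∉ ({-(Complex.I / r)} : Finset ℂ) := by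
    simp only [Finset.mem_singleton]
    field_simp
    norm_num [Complex.ext_iff]
  have hint : IntegrableOn f (({1 / r, -(1 / r), Complex.I / r, -(Complex.I / r)} : Finset ℂ) :
      Set ℂ) Measure.count := by
    rw [← Set.biUnion_of_singleton (({1 / r, -(1 / r), Complex.I / r, -(Complex.I / r)} :
      Finset ℂ) : Set ℂ), integrableOn_finite_biUnion (Finset.finite_toSet _)]
    exact fun z _ => integrableOn_singleton (by simp) (by simp)
  rw [weightValues_eq_coe, uniformOn, ProbabilityTheory.cond, integral_smul_measure,
    setIntegral_finset _ hint, Measure.count_apply_finset, Finset.sum_insert h1,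
    Finset.sum_insert h2, Finset.sum_insert h3, Finset.sum_singleton, Finset.card_insert_of_notMem h1,
    Finset.card_insert_of_notMem h2, Finset.card_insert_of_notMem h3, Finset.card_singleton]
  simp [Measure.real]
  ring

theorem integral_re_mul_weight {N : ℕ} (hN : 0 < N) (u : ℂ) :
    ∫ z, (z * u).re ∂(uniformOn (weightValues N)) = 0 := by
  rw [integral_uniformOn_weightValues hN fun z => (z * u).re]
  simp only [neg_mul, Complex.neg_re]
  ring

/-- The four values weigh `u.re²` and `u.im²` equally, so the phase of `u` drops out, and the real
and imaginary parts of a measurement each carry half of its energy. -/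
theorem integral_re_mul_weight_sq {N : ℕ} (hN : 0 < N) (u : ℂ) :
    ∫ z, (z * u).re ^ 2 ∂(uniformOn (weightValues N)) = ‖u‖ ^ 2 / (2 * N) := by
  rw [integral_uniformOn_weightValues hN fun z => (z * u).re ^ 2]
  have h1 : (1 / ((√(N : ℝ) : ℝ) : ℂ) * u).re = u.re / √(N : ℝ) := by
    rw [one_div, ← Complex.ofReal_inv, Complex.re_ofReal_mul]; ring
  have h2 : (Complex.I / ((√(N : ℝ) : ℝ) : ℂ) * u).re = -u.im / √(N : ℝ) := by
    rw [div_eq_mul_inv, ← Complex.ofReal_inv, mul_assoc, Complex.I_mul_re, Complex.im_ofReal_mul]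
    ring
  simp only [neg_mul, Complex.neg_re, h1, h2, div_pow, neg_sq, Real.sq_sqrt (Nat.cast_nonneg N)]
  rw [← Complex.normSq_eq_norm_sq, Complex.normSq_apply]
  have : (N : ℝ) ≠ 0 := by positivity
  field_simp
  ring

end WeightLaw

/-! ### Exponential moments of a single measurement -/

section Row

/-- The law of a row of the measurement matrix. -/
abbrev rowLaw (N : ℕ) : Measure (Fin N → ℂ) := Measure.pi fun _ => uniformOn (weightValues N)

/-- The law of the measurement matrix, with independent rows. -/
abbrev matrixLaw (M N : ℕ) : Measure (Fin M → Fin N → ℂ) := Measure.pi fun _ => rowLaw N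

variable {N : ℕ} (y : Fin N → ℂ)

/-- The real part of the inner product of a row with `y`, normalized. -/
def rowRe (a : Fin N → ℂ) : ℝ := ∑ n, √(N : ℝ) * (a n * y n).re

theorem measurable_rowRe : Measurable (rowRe y) := by
  unfold rowRe
  fun_prop

theorem iIndepFun_row : iIndepFun (fun n (a : Fin N → ℂ) => √(N : ℝ) * (a n * y n).re)
    (rowLaw N) :=
  iIndepFun_pi (X := fun n (z : ℂ) => √(N : ℝ) * (z * y n).re) fun n => by fun_prop

theorem integral_row_eval (n : Fin N) {f : ℂ → ℝ} (hf : Measurable f) :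
    ∫ a, f (a n) ∂(rowLaw N) = ∫ z, f z ∂(uniformOn (weightValues N)) := by
  have h := measurePreserving_eval (fun _ : Fin N => uniformOn (weightValues N)) n
  rw [← h.map_eq, integral_map h.measurable.aemeasurable hf.aestronglyMeasurable]

theorem ae_row_mem (n : Fin N) : ∀ᵐ a ∂(rowLaw N), a n ∈ weightValues N :=
  (measurePreserving_eval (fun _ : Fin N => uniformOn (weightValues N))
    n).quasiMeasurePreserving.ae (ae_mem_weightValues N)

theorem hasSubgaussianMGF_row_entry (hN : 0 < N) (n : Fin N) :
    HasSubgaussianMGF (fun a : Fin N → ℂ => √(N : ℝ) * (a n * y n).re) (‖y n‖₊ ^ 2) (rowLaw N) := by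
  have hs : 0 < √(N : ℝ) := Real.sqrt_pos.mpr (by exact_mod_cast hN)
  have hb : ∀ᵐ a ∂(rowLaw N), √(N : ℝ) * (a n * y n).re ∈ Set.Icc (-‖y n‖) ‖y n‖ := by
    filter_upwards [ae_row_mem n] with a ha
    rw [Set.mem_Icc, ← abs_le, abs_mul, abs_of_pos hs]
    calc √(N : ℝ) * |(a n * y n).re| ≤ √(N : ℝ) * ‖a n * y n‖ := by
          gcongr; exact Complex.abs_re_le_norm _
      _ = ‖y n‖ := by
          rw [norm_mul, norm_of_mem_weightValues ha]
          field_simp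
  have h := hasSubgaussianMGF_of_mem_Icc_of_integral_eq_zero (μ := rowLaw N)
    (X := fun a : Fin N → ℂ => √(N : ℝ) * (a n * y n).re) (by fun_prop) hb (by
      rw [integral_row_eval (f := fun z => √(N : ℝ) * (z * y n).re) n (by fun_prop),
        integral_const_mul, integral_re_mul_weight hN, mul_zero])
  convert h using 1
  ext
  push_cast
  rw [sub_neg_eq_add, Real.norm_eq_abs, abs_of_nonneg (by positivity)]
  ring

theorem sum_nnnorm_sq_eq_one {y : Fin N → ℂ} (hy : ∑ n, ‖y n‖ ^ 2 = 1) :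
    ∑ n, ‖y n‖₊ ^ 2 = 1 := by
  ext
  push_cast
  exact hy

theorem hasSubgaussianMGF_rowRe (hN : 0 < N) {y : Fin N → ℂ} (hy : ∑ n, ‖y n‖ ^ 2 = 1) :
    HasSubgaussianMGF (rowRe y) 1 (rowLaw N) := by
  rw [← sum_nnnorm_sq_eq_one hy]
  exact HasSubgaussianMGF.sum_of_iIndepFun (iIndepFun_row y)
    fun n _ => hasSubgaussianMGF_row_entry y hN n

theorem integral_rowRe_sq (hN : 0 < N) {y : Fin N → ℂ} (hy : ∑ n, ‖y n‖ ^ 2 = 1) :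
    ∫ a, rowRe y a ^ 2 ∂(rowLaw N) = 1 / 2 := by
  have hN' : (N : ℝ) ≠ 0 := by positivity
  have hmean : ∀ n, ∫ a, √(N : ℝ) * (a n * y n).re ∂(rowLaw N) = 0 := fun n => by
    rw [integral_row_eval (f := fun z => √(N : ℝ) * (z * y n).re) n (by fun_prop),
      integral_const_mul, integral_re_mul_weight hN, mul_zero]
  have hsub := fun n => hasSubgaussianMGF_row_entry y hN n
  have hv := IndepFun.variance_sum (s := Finset.univ)
    (X := fun n (a : Fin N → ℂ) => √(N : ℝ) * (a n * y n).re) (μ := rowLaw N)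
    (fun n _ => (hsub n).memLp 2) fun i _ j _ hij => (iIndepFun_row y).indepFun hij
  have hsum : (∑ n, fun a : Fin N → ℂ => √(N : ℝ) * (a n * y n).re) = rowRe y := by
    ext a; simp [rowRe]
  have hvar : ∀ n, Var[fun a : Fin N → ℂ => √(N : ℝ) * (a n * y n).re; rowLaw N] =
      ‖y n‖ ^ 2 / 2 := by
    intro n
    rw [variance_of_integral_eq_zero (hsub n).aemeasurable (hmean n)]
    simp_rw [mul_pow]
    rw [integral_row_eval (f := fun z => √(N : ℝ) ^ 2 * (z * y n).re ^ 2) n (by fun_prop),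
      integral_const_mul, integral_re_mul_weight_sq hN, Real.sq_sqrt (Nat.cast_nonneg N)]
    field_simp
  rw [hsum] at hv
  simp_rw [hvar] at hv
  rw [← Finset.sum_div, hy, variance_of_integral_eq_zero (measurable_rowRe y).aemeasurable] at hv
  · exact hv
  · unfold rowRe
    rw [integral_finsetSum _ fun n _ => (hsub n).integrable]
    exact Finset.sum_eq_zero fun n _ => hmean n

/-- The centred normalized energy of a single measurement of `y`. -/
def rowEnergy (a : Fin N → ℂ) : ℝ := N * ‖∑ n, a n * y n‖ ^ 2 - 1

/-- Since `Im z = Re (-i z)`, the imaginary part is again a `rowRe`, for a vector of the same norm;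
one sub-Gaussian bound serves both parts. -/
theorem rowEnergy_eq (a : Fin N → ℂ) :
    rowEnergy y a = rowRe y a ^ 2 + rowRe (fun n => -Complex.I * y n) a ^ 2 - 1 := by
  have h1 : rowRe y a = √(N : ℝ) * (∑ n, a n * y n).re := by
    rw [rowRe, Complex.re_sum, Finset.mul_sum]
  have h2 : rowRe (fun n => -Complex.I * y n) a = √(N : ℝ) * (∑ n, a n * y n).im := by
    rw [rowRe, Complex.im_sum, Finset.mul_sum]
    congr! 2 with n
    simp
    ring
  rw [h1, h2, rowEnergy, ← Complex.normSq_eq_norm_sq, Complex.normSq_apply, mul_pow, mul_pow,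
    Real.sq_sqrt (Nat.cast_nonneg N)]
  ring

theorem measurable_rowEnergy : Measurable (rowEnergy y) := by
  unfold rowEnergy
  fun_prop

theorem mgf_rowEnergy_le (hN : 0 < N) {y : Fin N → ℂ} (hy : ∑ n, ‖y n‖ ^ 2 = 1) {s : ℝ}
    (hs : |s| ≤ 1 / 16) :
    Integrable (fun a => Real.exp (s * rowEnergy y a)) (rowLaw N) ∧
      mgf (rowEnergy y) (rowLaw N) s ≤ Real.exp (1024 * s ^ 2) := by
  set y' : Fin N → ℂ := fun n => -Complex.I * y n with hy'def
  have hy' : ∑ n, ‖y' n‖ ^ 2 = 1 := by simpa [y'] using hy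
  have hX := hasSubgaussianMGF_rowRe hN hy
  have hY := hasSubgaussianMGF_rowRe hN hy'
  have mX := measurable_rowRe y
  have mY := measurable_rowRe y'
  have mW := measurable_rowEnergy y
  have hlin : ∫⁻ a, ENNReal.ofReal (Real.exp (|rowEnergy y a| / 8)) ∂(rowLaw N) ≤
      ENNReal.ofReal 2 := by
    -- The two parts need not be independent, so AM-GM separates the product of their exponentials.
    -- The resulting bound is `exp(1/8) √2 < 2`.
    have hpt : ∀ a, ENNReal.ofReal (Real.exp (|rowEnergy y a| / 8)) ≤
        ENNReal.ofReal (Real.exp (1 / 8) / 2) * (ENNReal.ofReal (Real.exp (rowRe y a ^ 2 / 4)) +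
          ENNReal.ofReal (Real.exp (rowRe y' a ^ 2 / 4))) := by
      intro a
      rw [← ENNReal.ofReal_add (by positivity) (by positivity),
        ← ENNReal.ofReal_mul (by positivity)]
      apply ENNReal.ofReal_le_ofReal
      have h1 : |rowEnergy y a| ≤ 1 + rowRe y a ^ 2 + rowRe y' a ^ 2 := by
        rw [rowEnergy_eq, abs_le]
        constructor <;> nlinarith [sq_nonneg (rowRe y a), sq_nonneg (rowRe y' a)]
      have h2 : Real.exp (|rowEnergy y a| / 8) ≤
          Real.exp (1 / 8) * (Real.exp (rowRe y a ^ 2 / 8) * Real.exp (rowRe y' a ^ 2 / 8)) := by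
        rw [← Real.exp_add, ← Real.exp_add, Real.exp_le_exp]
        linarith
      have h3 : ∀ x : ℝ, Real.exp (x / 4) = Real.exp (x / 8) ^ 2 := fun x => by
        rw [← Real.exp_nat_mul]; congr 1; push_cast; ring
      rw [h3, h3]
      have h4 := Real.exp_pos (1 / 8)
      refine h2.trans ?_
      nlinarith [mul_nonneg h4.le
        (sq_nonneg (Real.exp (rowRe y a ^ 2 / 8) - Real.exp (rowRe y' a ^ 2 / 8)))]
    refine (lintegral_mono hpt).trans ?_
    rw [lintegral_const_mul _ (by fun_prop), lintegral_add_left (by fun_prop)]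
    refine (mul_le_mul_right (add_le_add (lintegral_exp_sq_div_four_le hX)
      (lintegral_exp_sq_div_four_le hY)) _).trans ?_
    rw [← ENNReal.ofReal_add (by positivity) (by positivity), ← ENNReal.ofReal_mul (by positivity)]
    apply ENNReal.ofReal_le_ofReal
    have h5 : √2 ≤ (1.42 : ℝ) := Real.sqrt_le_iff.mpr (by norm_num)
    have h6 : Real.exp (1 / 8) ≤ 8 / 7 := by
      have h7 := Real.add_one_le_exp (-(1 / 8) : ℝ)
      rw [Real.exp_neg] at h7
      rw [le_div_iff₀ (by norm_num)]
      have h8 := Real.exp_pos (1 / 8)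
      have h9 := mul_le_mul_of_nonneg_left h7 h8.le
      rw [mul_inv_cancel₀ h8.ne'] at h9
      linarith
    nlinarith [Real.sqrt_nonneg 2, Real.exp_pos (1 / 8)]
  have hint : Integrable (fun a => Real.exp (|rowEnergy y a| / 8)) (rowLaw N) := by
    refine ⟨by fun_prop, ?_⟩
    rw [hasFiniteIntegral_iff_ofReal (.of_forall fun a => by positivity)]
    exact hlin.trans_lt ENNReal.ofReal_lt_top
  have hle : ∫ a, Real.exp (|rowEnergy y a| / 8) ∂(rowLaw N) ≤ 2 := by
    rw [← ENNReal.ofReal_le_ofReal_iff (by norm_num), ofReal_integral_eq_lintegral_ofReal hint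
      (.of_forall fun a => by positivity)]
    exact hlin
  have hmean : ∫ a, rowEnergy y a ∂(rowLaw N) = 0 := by
    simp_rw [rowEnergy_eq]
    have i1 : Integrable (fun a => rowRe y a ^ 2) (rowLaw N) := (hX.memLp 2).integrable_sq
    have i2 : Integrable (fun a => rowRe y' a ^ 2) (rowLaw N) := (hY.memLp 2).integrable_sq
    rw [integral_sub (f := fun a => rowRe y a ^ 2 + rowRe y' a ^ 2) (i1.add i2)
      (integrable_const 1), integral_add i1 i2, integral_rowRe_sq hN hy, integral_rowRe_sq hN hy']
    norm_num
  exact mgf_le_of_integral_exp_abs_le mW.aemeasurable hint hle hmean hs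

end Row

/-! ### Concentration of the measured norm of a fixed vector -/

section Concentration

theorem l2norm_sq {ι : Type*} [Fintype ι] (v : ι → ℂ) : l2norm v ^ 2 = ∑ i, ‖v i‖ ^ 2 := by
  rw [l2norm, EuclideanSpace.norm_sq_eq]

theorem l2norm_nonneg {ι : Type*} [Fintype ι] (v : ι → ℂ) : 0 ≤ l2norm v := norm_nonneg _

theorem l2norm_smul {ι : Type*} [Fintype ι] (c : ℂ) (v : ι → ℂ) :
    l2norm (c • v) = ‖c‖ * l2norm v := by
  rw [l2norm, WithLp.toLp_smul, norm_smul, l2norm]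

theorem l2norm_eq_zero {ι : Type*} [Fintype ι] {v : ι → ℂ} : l2norm v = 0 ↔ v = 0 := by
  rw [l2norm, norm_eq_zero, WithLp.toLp_eq_zero]

theorem l2norm_add_le {ι : Type*} [Fintype ι] (v w : ι → ℂ) :
    l2norm (v + w) ≤ l2norm v + l2norm w := by
  simp only [l2norm, WithLp.toLp_add]
  exact norm_add_le _ _

theorem abs_l2norm_sub_le {ι : Type*} [Fintype ι] (v w : ι → ℂ) :
    |l2norm v - l2norm w| ≤ l2norm (v - w) := by
  simp only [l2norm, WithLp.toLp_sub]
  exact abs_norm_sub_norm_le _ _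

variable {M N : ℕ}

theorem mgf_matrix_row_le (hN : 0 < N) {y : Fin N → ℂ} (hy : ∑ n, ‖y n‖ ^ 2 = 1) (m : Fin M)
    {s : ℝ} (hs : |s| ≤ 1 / 16) :
    Integrable (fun a : Fin M → Fin N → ℂ => Real.exp (s * rowEnergy y (a m))) (matrixLaw M N) ∧
      mgf (fun a : Fin M → Fin N → ℂ => rowEnergy y (a m)) (matrixLaw M N) s ≤
        Real.exp (1024 * s ^ 2) := by
  have hp := measurePreserving_eval (fun _ : Fin M => rowLaw N) m
  obtain ⟨h1, h2⟩ := mgf_rowEnergy_le hN hy hs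
  refine ⟨hp.integrable_comp_of_integrable h1, ?_⟩
  have mW := measurable_rowEnergy y
  rw [← hp.map_eq, mgf, integral_map hp.measurable.aemeasurable (by fun_prop)] at h2
  exact h2

/-- Deviations of a norm become deviations of its square: `x > 1 + t` gives `x² - 1 > 2t + t²`, and
`0 ≤ x < 1 - t` gives `1 - x² > 2t - t²`. For `t < 1` both thresholds, and their squares, dominate
`t²`, so `u = t²` serves both tails; for `t ≥ 1` the lower tail is empty. -/
theorem measureReal_unit_isometry_failure_le (hN : 0 < N) (hM : 0 < M) {y : Fin N → ℂ}
    (hy : l2norm y = 1) {t : ℝ} (ht : 0 < t) :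
    (matrixLaw M N).real {a | ¬ |√((N : ℝ) / M) * l2norm (Matrix.of a *ᵥ y) - 1| ≤ t} ≤
      2 * Real.exp (-(t ^ 2 * M / 4096)) := by
  have hM' : (0 : ℝ) < M := by exact_mod_cast hM
  have hy2 : ∑ n, ‖y n‖ ^ 2 = 1 := by rw [← l2norm_sq, hy, one_pow]
  have mW := measurable_rowEnergy y
  have hind : iIndepFun (fun (m : Fin M) (a : Fin M → Fin N → ℂ) => rowEnergy y (a m))
      (matrixLaw M N) :=
    iIndepFun_pi (X := fun _ => rowEnergy y) fun m => mW.aemeasurable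
  have hind' : iIndepFun (fun (m : Fin M) (a : Fin M → Fin N → ℂ) => -rowEnergy y (a m))
      (matrixLaw M N) :=
    iIndepFun_pi (X := fun _ a => -rowEnergy y a) fun m => mW.neg.aemeasurable
  have hup := measureReal_sum_ge_le hind (fun m => by fun_prop)
    (fun m s hs => mgf_matrix_row_le hN hy2 m hs) (t := 2 * t + t ^ 2) (u := t ^ 2) (by positivity)
    (by linarith) (by nlinarith [pow_pos ht 3, pow_pos ht 4])
  have hsum : ∀ a : Fin M → Fin N → ℂ,
      ∑ m, rowEnergy y (a m) = ((√((N : ℝ) / M) * l2norm (Matrix.of a *ᵥ y)) ^ 2 - 1) * M := by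
    intro a
    rw [mul_pow, Real.sq_sqrt (by positivity), l2norm_sq]
    simp only [rowEnergy, Finset.sum_sub_distrib, ← Finset.mul_sum, Matrix.mulVec, dotProduct,
      Matrix.of_apply, Finset.sum_const, Finset.card_univ, Fintype.card_fin, nsmul_eq_mul, mul_one]
    field_simp
  have hlow : (matrixLaw M N).real {a | √((N : ℝ) / M) * l2norm (Matrix.of a *ᵥ y) < 1 - t} ≤
      Real.exp (-(t ^ 2 * M / 4096)) := by
    by_cases h1 : t < 1
    · refine le_trans (measureReal_mono fun a ha => ?_)
        (measureReal_sum_ge_le hind' (fun m => by fun_prop)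
          (fun m s hs => ?_) (t := 2 * t - t ^ 2) (u := t ^ 2) (by nlinarith) (by nlinarith)
          (pow_le_pow_left₀ ht.le (by nlinarith) 2))
      · rw [Set.mem_ofPred_eq] at ha ⊢
        rw [Finset.sum_neg_distrib, hsum, ← neg_mul]
        refine mul_le_mul_of_nonneg_right ?_ hM'.le
        have h0 : 0 ≤ √((N : ℝ) / M) * l2norm (Matrix.of a *ᵥ y) :=
          mul_nonneg (Real.sqrt_nonneg _) (l2norm_nonneg _)
        nlinarith
      · have h2 := mgf_matrix_row_le hN hy2 m (s := -s) (by rwa [abs_neg])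
        rw [neg_sq] at h2
        refine ⟨by simpa using h2.1, le_trans (le_of_eq ?_) h2.2⟩
        simp [mgf]
    · rw [show {a : Fin M → Fin N → ℂ | √((N : ℝ) / M) * l2norm (Matrix.of a *ᵥ y) < 1 - t} = ∅ from
        Set.eq_empty_of_forall_notMem fun a ha => by
          rw [Set.mem_ofPred_eq] at ha
          have h0 : 0 ≤ √((N : ℝ) / M) * l2norm (Matrix.of a *ᵥ y) :=
            mul_nonneg (Real.sqrt_nonneg _) (l2norm_nonneg _)
          linarith]
      simp only [measureReal_empty]
      positivity
  have hsub : {a | ¬ |√((N : ℝ) / M) * l2norm (Matrix.of a *ᵥ y) - 1| ≤ t} ⊆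
      {a : Fin M → Fin N → ℂ | (2 * t + t ^ 2) * M ≤ ∑ m, rowEnergy y (a m)} ∪
        {a | √((N : ℝ) / M) * l2norm (Matrix.of a *ᵥ y) < 1 - t} := by
    intro a ha
    simp only [Set.mem_ofPred_eq, abs_le, not_and_or, not_le] at ha
    rcases ha with ha | ha
    · right
      rw [Set.mem_ofPred_eq]
      linarith
    · left
      rw [Set.mem_ofPred_eq, hsum]
      refine mul_le_mul_of_nonneg_right ?_ hM'.le
      nlinarith
  calc _ ≤ _ := measureReal_mono hsub
    _ ≤ _ := measureReal_union_le _ _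
    _ ≤ _ := by linarith

/-- A fixed vector is measured almost isometrically, except on an event of exponentially small
probability. -/
theorem measureReal_isometry_failure_le (hN : 0 < N) (hM : 0 < M) (y : Fin N → ℂ)
    {t : ℝ} (ht : 0 < t) :
    (matrixLaw M N).real
        {a | ¬ |√((N : ℝ) / M) * l2norm (Matrix.of a *ᵥ y) - l2norm y| ≤ t * l2norm y} ≤
      2 * Real.exp (-(t ^ 2 * M / 4096)) := by
  rcases (l2norm_nonneg y).eq_or_lt with h0 | h0
  · have hy := l2norm_eq_zero.mp h0.symm
    have : {a : Fin M → Fin N → ℂ | ¬ |√((N : ℝ) / M) * l2norm (Matrix.of a *ᵥ y) - l2norm y| ≤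
        t * l2norm y} = ∅ := by
      have hz : ∀ k, l2norm (0 : Fin k → ℂ) = 0 := fun k => l2norm_eq_zero.mpr rfl
      simp [hy, hz]
    rw [this, measureReal_empty]
    positivity
  · set c : ℂ := (((l2norm y)⁻¹ : ℝ) : ℂ) with hc
    have hcn : ‖c‖ = (l2norm y)⁻¹ := by
      rw [hc, Complex.norm_real, Real.norm_eq_abs, abs_of_pos (inv_pos.mpr h0)]
    have hu : l2norm (c • y) = 1 := by rw [l2norm_smul, hcn, inv_mul_cancel₀ h0.ne']
    refine le_trans (le_of_eq ?_) (measureReal_unit_isometry_failure_le hN hM hu ht)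
    congr 1
    ext a
    simp only [Set.mem_ofPred_eq, Matrix.mulVec_smul, l2norm_smul, hcn]
    have e : √((N : ℝ) / M) * ((l2norm y)⁻¹ * l2norm (Matrix.of a *ᵥ y)) - 1 =
        (l2norm y)⁻¹ * (√((N : ℝ) / M) * l2norm (Matrix.of a *ᵥ y) - l2norm y) := by
      field_simp
    rw [e, abs_mul, abs_of_pos (inv_pos.mpr h0), inv_mul_le_iff₀ h0, mul_comm t]

/-- Joint independence over index pairs gives a product law on pairs; currying makes it a product
over rows, on which Bernstein's inequality acts. -/
theorem hasLaw_matrixLaw {Ω : Type*} [MeasurableSpace Ω] {P : Measure Ω}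
    {A : Ω → Matrix (Fin M) (Fin N) ℂ} (hA : IsUniformMeasurementMatrix P A) :
    HasLaw (fun w => (Matrix.of.symm (A w) : Fin M → Fin N → ℂ)) (matrixLaw M N) P := by
  have hm : ∀ p : Fin M × Fin N, AEMeasurable (fun w => A w p.1 p.2) P :=
    fun p => (hA.hasLaw p.1 p.2).aemeasurable
  have h1 := hA.indep.map_fun_eq_pi_map hm
  simp_rw [fun p : Fin M × Fin N => (hA.hasLaw p.1 p.2).map_eq] at h1
  have h2 := Measure.infinitePi_map_curry (ι := Fin M) (κ := Fin N)
    (fun _ _ => uniformOn (weightValues N))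
  simp_rw [Measure.infinitePi_eq_pi] at h2
  rw [← h1, AEMeasurable.map_map_of_aemeasurable (MeasurableEquiv.measurable _).aemeasurable
    (aemeasurable_pi_iff.mpr hm)] at h2
  exact ⟨aemeasurable_pi_iff.mpr fun m => aemeasurable_pi_iff.mpr fun n => hm (m, n), h2⟩

end Concentration

/-! ### Norm estimates and a deterministic operator bound -/

section Norm

variable {ι : Type*} [Fintype ι]

theorem l2norm_sum_le {κ : Type*} (s : Finset κ) (f : κ → ι → ℂ) :
    l2norm (∑ k ∈ s, f k) ≤ ∑ k ∈ s, l2norm (f k) := by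
  simp only [l2norm, WithLp.toLp_sum]
  exact norm_sum_le _ _

theorem l2norm_le_mul {c : ℝ} (hc : 0 ≤ c) {v w : ι → ℂ} (h : ∀ i, ‖v i‖ ≤ c * ‖w i‖) :
    l2norm v ≤ c * l2norm w := by
  rw [← abs_of_nonneg (l2norm_nonneg v), ← abs_of_nonneg (mul_nonneg hc (l2norm_nonneg w)),
    ← sq_le_sq, mul_pow, l2norm_sq, l2norm_sq, Finset.mul_sum]
  gcongr with i
  rw [← mul_pow]
  exact pow_le_pow_left₀ (norm_nonneg _) (h i) 2

theorem l2norm_congr_norm {v w : ι → ℂ} (h : ∀ i, ‖v i‖ = ‖w i‖) : l2norm v = l2norm w := by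
  rw [← abs_of_nonneg (l2norm_nonneg v), ← abs_of_nonneg (l2norm_nonneg w), ← sq_eq_sq_iff_abs_eq_abs,
    l2norm_sq, l2norm_sq]
  simp_rw [h]

theorem norm_apply_le_l2norm (v : ι → ℂ) (i : ι) : ‖v i‖ ≤ l2norm v :=
  PiLp.norm_apply_le (WithLp.toLp 2 v) i

/-- A matrix with entries of modulus `1 / √N` expands norms at most by `√M`. -/
theorem sqrt_mul_l2norm_mulVec_le {M N : ℕ} (hM : 0 < M) (hN : 0 < N)
    {A : Matrix (Fin M) (Fin N) ℂ} (hA : ∀ i j, ‖A i j‖ = 1 / √(N : ℝ)) (v : Fin N → ℂ) :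
    √((N : ℝ) / M) * l2norm (A *ᵥ v) ≤ √(N : ℝ) * l2norm v := by
  have hN' : (0 : ℝ) < N := by exact_mod_cast hN
  have hM' : (0 : ℝ) < M := by exact_mod_cast hM
  have hrow : ∀ i, ‖(A *ᵥ v) i‖ ^ 2 ≤ l2norm v ^ 2 := by
    intro i
    have h1 : ‖(A *ᵥ v) i‖ ≤ ∑ j, ‖A i j‖ * ‖v j‖ := by
      exact (norm_sum_le Finset.univ fun j => A i j * v j).trans (le_of_eq (by simp))
    calc ‖(A *ᵥ v) i‖ ^ 2 ≤ (∑ j, ‖A i j‖ * ‖v j‖) ^ 2 := by gcongr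
      _ ≤ (∑ j, ‖A i j‖ ^ 2) * ∑ j, ‖v j‖ ^ 2 := Finset.sum_mul_sq_le_sq_mul_sq _ _ _
      _ = l2norm v ^ 2 := by
        simp_rw [hA, div_pow, Real.sq_sqrt hN'.le]
        simp [hN'.ne', l2norm_sq]
  have h2 : l2norm (A *ᵥ v) ^ 2 ≤ M * l2norm v ^ 2 := by
    rw [l2norm_sq (A *ᵥ v)]
    exact (Finset.sum_le_sum fun i _ => hrow i).trans (by simp)
  refine abs_le_of_sq_le_sq' ?_ (mul_nonneg (Real.sqrt_nonneg _) (l2norm_nonneg v)) |>.2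
  rw [mul_pow, mul_pow, Real.sq_sqrt (by positivity), Real.sq_sqrt hN'.le]
  calc (N : ℝ) / M * l2norm (A *ᵥ v) ^ 2 ≤ (N : ℝ) / M * (M * l2norm v ^ 2) := by gcongr
    _ = N * l2norm v ^ 2 := by field_simp

end Norm

/-! ### Parametrization of the tangent spans and the grid -/

section Synthesis

variable {N K : ℕ}

/-- The centred index `n - (N - 1) / 2`. -/
def centredIndex (n : Fin N) : ℝ := (n : ℕ) - ((N : ℝ) - 1) / 2

/-- The unweighted sinusoid of frequency `ω`. -/
def phase (ω : ℝ) (n : Fin N) : ℂ :=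
  Complex.exp (Complex.I * ((ω * centredIndex n : ℝ) : ℂ))

theorem abs_centredIndex_le (n : Fin N) : |centredIndex n| ≤ N / 2 := by
  have h1 : ((n : ℕ) : ℝ) + 1 ≤ N := by exact_mod_cast n.2
  have h2 : (0 : ℝ) ≤ (n : ℕ) := Nat.cast_nonneg _
  rw [centredIndex, abs_le]
  constructor <;> linarith

theorem norm_phase (ω : ℝ) (n : Fin N) : ‖phase ω n‖ = 1 := by
  rw [phase, mul_comm, Complex.norm_exp_ofReal_mul_I]

theorem norm_phase_sub_le (ω ω' : ℝ) (n : Fin N) :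
    ‖phase ω n - phase ω' n‖ ≤ N / 2 * |ω - ω'| := by
  have h : phase ω n - phase ω' n =
      phase ω' n * (Complex.exp (Complex.I * (((ω - ω') * centredIndex n : ℝ) : ℂ)) - 1) := by
    rw [mul_sub, mul_one, phase, phase, ← Complex.exp_add]
    congr 2
    push_cast
    ring
  rw [h, norm_mul, norm_phase, one_mul]
  refine (Real.norm_exp_I_mul_ofReal_sub_one_le).trans ?_
  rw [Real.norm_eq_abs, abs_mul, mul_comm]
  gcongr
  exact abs_centredIndex_le n

/-- The period is `4π` and not `2π` because the centred indices are half-integers when `N` is even.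
-/
theorem phase_add_int_mul (ω : ℝ) (k : ℤ) (n : Fin N) :
    phase (ω + k * (4 * Real.pi)) n = phase ω n := by
  rw [phase, phase, Complex.exp_eq_exp_iff_exists_int]
  refine ⟨k * (2 * (n : ℕ) - (N - 1)), ?_⟩
  rw [centredIndex]
  push_cast
  ring

theorem sinusoid_eq (h : Fin N → ℂ) (ω : ℝ) (n : Fin N) :
    sinusoid h ω n = h n * phase ω n := by
  rw [sinusoid, phase, centredIndex]
  push_cast
  ring_nf

theorem hasDerivAt_sinusoid (h : Fin N → ℂ) (ω : ℝ) :
    HasDerivAt (sinusoid h)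
      (fun n => phase ω n * (Complex.I * (centredIndex n : ℂ) * h n)) ω := by
  rw [hasDerivAt_pi]
  intro n
  have h1 : (fun x : ℝ => sinusoid h x n) =
      fun x : ℝ => h n * Complex.exp ((x : ℂ) * (Complex.I * (centredIndex n : ℂ))) := by
    ext x
    rw [sinusoid_eq, phase]
    push_cast
    ring_nf
  rw [h1]
  have h2 := (((Complex.ofRealCLM.hasDerivAt (x := ω)).mul_const
    (Complex.I * (centredIndex n : ℂ))).cexp).const_mul (h n)
  refine h2.congr_deriv ?_
  rw [phase, Complex.ofRealCLM_apply, Complex.ofRealCLM_apply, Complex.ofReal_one]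
  push_cast
  ring_nf

/-- The normalized derivative of the sinusoid at frequency `0`. -/
def tangentWeights (h : Fin N → ℂ) : Fin N → ℂ :=
  ((1 / l2norm (fun n => Complex.I * (centredIndex n : ℂ) * h n) : ℝ) : ℂ) •
    fun n => Complex.I * (centredIndex n : ℂ) * h n

/-- Modulation by a unimodular phase does not change the norm of the derivative, so all tangent
columns are modulations of one fixed window. -/
theorem tau_mul_deriv_sinusoid (h : Fin N → ℂ) (ω : ℝ) (n : Fin N) :
    (tau h ω : ℂ) * deriv (sinusoid h) ω n = phase ω n * tangentWeights h n := by
  rw [tau, (hasDerivAt_sinusoid h ω).deriv, tangentWeights,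
    l2norm_congr_norm (w := fun n => Complex.I * (centredIndex n : ℂ) * h n)
      fun i => by rw [norm_mul, norm_phase, one_mul]]
  simp only [Pi.smul_apply, smul_eq_mul]
  ring

/-- An inequality, because `1 / 0 = 0` makes the vector zero if the derivative vanishes. -/
theorem l2norm_tangentWeights_le (h : Fin N → ℂ) : l2norm (tangentWeights h) ≤ 1 := by
  rw [tangentWeights, l2norm_smul, Complex.norm_real, Real.norm_eq_abs,
    abs_of_nonneg (one_div_nonneg.mpr (l2norm_nonneg _)), one_div]
  exact inv_mul_le_one

/-- The superposition of `K` modulated copies of combinations of `h` and `g`. -/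
def synthesis (h g : Fin N → ℂ) (ω : Fin K → ℝ) (p r : Fin K → ℂ) : Fin N → ℂ :=
  ∑ l, fun n => phase (ω l) n * (p l * h n + r l * g n)

theorem tangentMatrix_mulVec (h : Fin N → ℂ) (ω : Fin K → ℝ) (q : Fin K ⊕ Fin K → ℂ) :
    tangentMatrix h ω *ᵥ q =
      synthesis h (tangentWeights h) ω (fun l => q (.inl l)) (fun l => q (.inr l)) := by
  ext n
  simp only [Matrix.mulVec, dotProduct, tangentMatrix, Matrix.of_apply, Fintype.sum_sum_type,
    Sum.elim_inl, Sum.elim_inr, synthesis, Finset.sum_apply, ← Finset.sum_add_distrib]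
  refine Finset.sum_congr rfl fun l _ => ?_
  rw [sinusoid_eq, tau_mul_deriv_sinusoid]
  ring

theorem synthesis_add_int_mul (h g : Fin N → ℂ) (ω : Fin K → ℝ) (k : Fin K → ℤ)
    (p r : Fin K → ℂ) :
    synthesis h g (fun l => ω l + k l * (4 * Real.pi)) p r = synthesis h g ω p r := by
  simp only [synthesis, phase_add_int_mul]

/-- Each summand moves by at most `(N/2)ρ · 2R` through its phase and by `2 · 2ρ` through its two
coefficients. -/
theorem l2norm_synthesis_sub_le {h g : Fin N → ℂ} (hh : l2norm h ≤ 1) (hg : l2norm g ≤ 1)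
    {ω ω' : Fin K → ℝ} {p r p' r' : Fin K → ℂ} {R ρ : ℝ} (hρ : 0 ≤ ρ)
    (hω : ∀ l, |ω l - ω' l| ≤ ρ) (hp : ∀ l, ‖p l‖ ≤ R) (hr : ∀ l, ‖r l‖ ≤ R)
    (hpp : ∀ l, ‖p l - p' l‖ ≤ 2 * ρ) (hrr : ∀ l, ‖r l - r' l‖ ≤ 2 * ρ) :
    l2norm (synthesis h g ω p r - synthesis h g ω' p' r') ≤ K * (ρ * (N * R + 4)) := by
  have hcomb : ∀ (a b : ℂ) (x : ℝ), ‖a‖ ≤ x → ‖b‖ ≤ x →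
      l2norm (fun n => a * h n + b * g n) ≤ 2 * x := by
    intro a b x ha hb
    calc l2norm (a • h + b • g) ≤ ‖a‖ * l2norm h + ‖b‖ * l2norm g := by
          rw [← l2norm_smul, ← l2norm_smul]; exact l2norm_add_le _ _
      _ ≤ ‖a‖ * 1 + ‖b‖ * 1 := by gcongr
      _ ≤ 2 * x := by linarith
  rw [synthesis, synthesis, ← Finset.sum_sub_distrib]
  refine (l2norm_sum_le _ _).trans ?_
  refine (Finset.sum_le_card_nsmul _ _ (ρ * (N * R + 4)) fun l _ => ?_).trans (by simp)
  have hsplit : ((fun n => phase (ω l) n * (p l * h n + r l * g n)) -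
      fun n => phase (ω' l) n * (p' l * h n + r' l * g n)) =
      (fun n => (phase (ω l) n - phase (ω' l) n) * (p l * h n + r l * g n)) +
      fun n => phase (ω' l) n * ((p l - p' l) * h n + (r l - r' l) * g n) := by
    ext n
    simp only [Pi.sub_apply, Pi.add_apply]
    ring
  rw [hsplit]
  refine (l2norm_add_le _ _).trans ?_
  have h1 : l2norm (fun n => (phase (ω l) n - phase (ω' l) n) * (p l * h n + r l * g n)) ≤
      (N / 2 * ρ) * l2norm (fun n => p l * h n + r l * g n) := by
    refine l2norm_le_mul (by positivity) fun n => ?_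
    rw [norm_mul]
    gcongr
    refine (norm_phase_sub_le _ _ n).trans ?_
    gcongr
    exact hω l
  have h2 : l2norm (fun n => phase (ω' l) n * ((p l - p' l) * h n + (r l - r' l) * g n)) =
      l2norm (fun n => (p l - p' l) * h n + (r l - r' l) * g n) :=
    l2norm_congr_norm fun n => by rw [norm_mul, norm_phase, one_mul]
  have h3 := hcomb _ _ _ (hp l) (hr l)
  have h4 := hcomb _ _ _ (hpp l) (hrr l)
  have h5 : (N / 2 * ρ) * l2norm (fun n => p l * h n + r l * g n) ≤ (N / 2 * ρ) * (2 * R) := by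
    gcongr
  rw [h2]
  linarith

/-- The synthesis of a point of the grid of mesh `ρ`. -/
def gridPoint (h g : Fin N → ℂ) (ρ : ℝ) (z : Fin K × Fin 5 → ℤ) : Fin N → ℂ :=
  synthesis h g (fun l => ρ * z (l, 0))
    (fun l => (⟨ρ * z (l, 1), ρ * z (l, 2)⟩ : ℂ)) (fun l => (⟨ρ * z (l, 3), ρ * z (l, 4)⟩ : ℂ))

theorem abs_sub_mul_floor_le {ρ : ℝ} (hρ : 0 < ρ) (x : ℝ) : |x - ρ * ⌊x / ρ⌋| ≤ ρ := by
  have h1 := Int.floor_le (x / ρ)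
  have h2 := Int.lt_floor_add_one (x / ρ)
  rw [le_div_iff₀ hρ] at h1
  rw [div_lt_iff₀ hρ] at h2
  rw [abs_le]
  constructor <;> linarith

theorem abs_floor_div_le {ρ x R : ℝ} (hρ : 0 < ρ) (hx : |x| ≤ R) {B : ℤ} (hB : R / ρ + 1 ≤ B) :
    ⌊x / ρ⌋ ∈ Finset.Icc (-B) B := by
  have h0 : |x / ρ| ≤ R / ρ := by
    rw [abs_div, abs_of_pos hρ]
    gcongr
  have h3 := abs_le.mp h0
  have h1 := Int.floor_le (x / ρ)
  have h2 := Int.lt_floor_add_one (x / ρ)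
  rw [Finset.mem_Icc]
  constructor
  · have : (-B : ℝ) ≤ (⌊x / ρ⌋ : ℝ) := by linarith
    exact_mod_cast this
  · have : (⌊x / ρ⌋ : ℝ) ≤ (B : ℝ) := by linarith
    exact_mod_cast this

theorem exists_gridPoint_near {h g : Fin N → ℂ} (hh : l2norm h ≤ 1) (hg : l2norm g ≤ 1)
    (ω : Fin K → ℝ) {p r : Fin K → ℂ} {R ρ : ℝ} (hρ : 0 < ρ)
    (hp : ∀ l, ‖p l‖ ≤ R) (hr : ∀ l, ‖r l‖ ≤ R) {B : ℤ} (hB1 : 4 * Real.pi / ρ + 1 ≤ B)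
    (hB2 : R / ρ + 1 ≤ B) :
    ∃ z ∈ Fintype.piFinset (fun _ : Fin K × Fin 5 => Finset.Icc (-B) B),
      l2norm (synthesis h g ω p r - gridPoint h g ρ z) ≤ K * (ρ * (N * R + 4)) := by
  have hpi : 0 < 4 * Real.pi := by positivity
  -- Reduction modulo `4π` lets a finite box of frequencies serve all of `ℝ^K`.
  set ω' : Fin K → ℝ := fun l => 4 * Real.pi * Int.fract (ω l / (4 * Real.pi)) with hω'
  have hωeq : synthesis h g ω p r = synthesis h g ω' p r := by
    rw [← synthesis_add_int_mul h g ω' (fun l => ⌊ω l / (4 * Real.pi)⌋)]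
    congr 1
    ext l
    rw [hω', mul_comm (_ : ℝ) (4 * Real.pi), ← mul_add, Int.fract_add_floor]
    field_simp
  have hωb : ∀ l, |ω' l| ≤ 4 * Real.pi := fun l => by
    rw [hω', abs_mul, abs_of_pos hpi, abs_of_nonneg (Int.fract_nonneg _)]
    exact mul_le_of_le_one_right hpi.le (Int.fract_lt_one _).le
  refine ⟨fun i => ![⌊ω' i.1 / ρ⌋, ⌊(p i.1).re / ρ⌋, ⌊(p i.1).im / ρ⌋, ⌊(r i.1).re / ρ⌋,
    ⌊(r i.1).im / ρ⌋] i.2, ?_, ?_⟩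
  · rw [Fintype.mem_piFinset]
    rintro ⟨l, j⟩
    have hre := fun w : ℂ => Complex.abs_re_le_norm w
    have him := fun w : ℂ => Complex.abs_im_le_norm w
    fin_cases j
    · exact abs_floor_div_le hρ (hωb l) hB1
    · exact abs_floor_div_le hρ ((hre _).trans (hp l)) hB2
    · exact abs_floor_div_le hρ ((him _).trans (hp l)) hB2
    · exact abs_floor_div_le hρ ((hre _).trans (hr l)) hB2
    · exact abs_floor_div_le hρ ((him _).trans (hr l)) hB2
  · have hround : ∀ w : ℂ, ‖w - ⟨ρ * ⌊w.re / ρ⌋, ρ * ⌊w.im / ρ⌋⟩‖ ≤ 2 * ρ := fun w => by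
      refine (Complex.norm_le_abs_re_add_abs_im _).trans ?_
      have h1 := abs_sub_mul_floor_le hρ w.re
      have h2 := abs_sub_mul_floor_le hρ w.im
      simp only [Complex.sub_re, Complex.sub_im]
      linarith
    rw [hωeq, gridPoint]
    exact l2norm_synthesis_sub_le hh hg hρ.le (fun l => abs_sub_mul_floor_le hρ (ω' l)) hp hr
      (fun l => hround (p l)) (fun l => hround (r l))

end Synthesis

/-! ### From the grid to all well-conditioned spans -/

section Isometry

variable {M N K : ℕ}

theorem mul_l2norm_le_of_mem_wellConditioned {h : Fin N → ℂ} {δ : ℝ} {ω : Fin K → ℝ}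
    (hω : ω ∈ wellConditioned h K δ) (q : Fin K ⊕ Fin K → ℂ) :
    δ * l2norm q ≤ l2norm (tangentMatrix h ω *ᵥ q) := by
  by_cases hq : q = 0
  · subst hq
    rw [l2norm_eq_zero.mpr rfl, mul_zero]
    exact l2norm_nonneg _
  · have hpos : 0 < l2norm q := (l2norm_nonneg q).lt_of_ne' fun h0 => hq (l2norm_eq_zero.mp h0)
    rw [← le_div_iff₀ hpos]
    refine le_trans hω (ciInf_le (f := fun q : {q : Fin K ⊕ Fin K → ℂ // q ≠ 0} =>
      l2norm (tangentMatrix h ω *ᵥ q.1) / l2norm q.1) ⟨0, ?_⟩ ⟨q, hq⟩)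
    rintro _ ⟨q', rfl⟩
    exact div_nonneg (l2norm_nonneg _) (l2norm_nonneg _)

/-- A basis vector selects a sinusoid column, whose norm is `‖h‖ = 1`. -/
theorem le_one_of_mem_wellConditioned (hK : 0 < K) {h : Fin N → ℂ} (hh : l2norm h = 1) {δ : ℝ}
    {ω : Fin K → ℝ} (hω : ω ∈ wellConditioned h K δ) : δ ≤ 1 := by
  have h1 := mul_l2norm_le_of_mem_wellConditioned hω (Pi.single (.inl ⟨0, hK⟩) 1)
  have h2 : l2norm (Pi.single (.inl ⟨0, hK⟩) 1 : Fin K ⊕ Fin K → ℂ) = 1 := by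
    rw [l2norm, ← PiLp.single, PiLp.norm_single, norm_one]
  have h3 : l2norm (tangentMatrix h ω *ᵥ Pi.single (.inl ⟨0, hK⟩) 1) = 1 := by
    rw [Matrix.mulVec_single_one, ← hh]
    refine l2norm_congr_norm fun n => ?_
    simp [tangentMatrix, Matrix.col, sinusoid_eq, norm_phase]
  rwa [h2, h3, mul_one] at h1

/-- Near-isometry on a grid extends to the spans of all well-conditioned tangent matrices. -/
theorem isIsometryOnSpan_of_grid (hM : 0 < M) (hN : 0 < N) {h : Fin N → ℂ}
    (hh : l2norm h = 1) {ε δ ρ : ℝ} (hδ : 0 < δ) (hρ : 0 < ρ) (hε : 0 < ε)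
    (hεN : ε < √(N : ℝ)) {B : ℤ} (hB1 : 4 * Real.pi / ρ + 1 ≤ B) (hB2 : δ⁻¹ / ρ + 1 ≤ B)
    (hmesh : K * (ρ * (N * δ⁻¹ + 4)) ≤ ε / (4 * N))
    {A : Matrix (Fin M) (Fin N) ℂ} (hA : ∀ i j, ‖A i j‖ = 1 / √(N : ℝ))
    (hgrid : ∀ z ∈ Fintype.piFinset (fun _ : Fin K × Fin 5 => Finset.Icc (-B) B),
      |√((N : ℝ) / M) * l2norm (A *ᵥ gridPoint h (tangentWeights h) ρ z) -
        l2norm (gridPoint h (tangentWeights h) ρ z)| ≤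
          ε / 4 * l2norm (gridPoint h (tangentWeights h) ρ z))
    {ω : Fin K → ℝ} (hω : ω ∈ wellConditioned h K δ) :
    IsIsometryOnSpan ε A (tangentMatrix h ω) := by
  intro q hq
  have hN1 : (1 : ℝ) ≤ N := by exact_mod_cast hN
  have hpos : 0 < l2norm (tangentMatrix h ω *ᵥ q) :=
    (l2norm_nonneg _).lt_of_ne' fun h0 => hq (l2norm_eq_zero.mp h0)
  set c : ℂ := (((l2norm (tangentMatrix h ω *ᵥ q))⁻¹ : ℝ) : ℂ) with hc
  have hcn : ‖c‖ = (l2norm (tangentMatrix h ω *ᵥ q))⁻¹ := by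
    rw [hc, Complex.norm_real, Real.norm_eq_abs, abs_of_pos (inv_pos.mpr hpos)]
  set v := tangentMatrix h ω *ᵥ (c • q) with hv
  have hv1 : l2norm v = 1 := by
    rw [hv, Matrix.mulVec_smul, l2norm_smul, hcn, inv_mul_cancel₀ hpos.ne']
  have hgoal : √((N : ℝ) / M) * (l2norm (A *ᵥ (tangentMatrix h ω *ᵥ q)) /
      l2norm (tangentMatrix h ω *ᵥ q)) = √((N : ℝ) / M) * l2norm (A *ᵥ v) := by
    rw [hv, Matrix.mulVec_smul, Matrix.mulVec_smul, l2norm_smul, hcn,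
      div_eq_inv_mul (l2norm _) (l2norm _)]
  have hqn : ∀ i, ‖(c • q) i‖ ≤ δ⁻¹ := by
    intro i
    refine (norm_apply_le_l2norm _ i).trans ?_
    rw [← one_div, le_div_iff₀ hδ, mul_comm, ← hv1]
    exact mul_l2norm_le_of_mem_wellConditioned hω _
  obtain ⟨z, hz, hnear⟩ := exists_gridPoint_near hh.le (l2norm_tangentWeights_le h) ω hρ
    (fun l => hqn (.inl l)) (fun l => hqn (.inr l)) hB1 hB2
  rw [← tangentMatrix_mulVec, ← hv] at hnear
  set v' := gridPoint h (tangentWeights h) ρ z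
  have hη := hnear.trans hmesh
  have hsq : √(N : ℝ) ≤ N := by
    rw [Real.sqrt_le_left (by linarith)]; nlinarith
  -- The mesh error `ε/(4N)` leaves room for the factor `√N` lost in the operator bound. The total
  -- error is at most `ε/4` from `A(v - v')`, `ε/4` from `‖v'‖ - 1`, and `(ε/4)(5/4)` from the grid,
  -- where `‖v'‖ ≤ 5/4`.
  have hη1 : √(N : ℝ) * l2norm (v - v') ≤ ε / 4 := by
    calc √(N : ℝ) * l2norm (v - v') ≤ N * (ε / (4 * N)) := by
          gcongr
          exact l2norm_nonneg _
      _ = ε / 4 := by field_simp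
  have hη2 : l2norm (v - v') ≤ ε / 4 := by
    refine hη.trans ?_
    gcongr
    linarith
  have hη3 : l2norm (v - v') ≤ 1 / 4 := by
    refine hη.trans ?_
    rw [div_le_div_iff₀ (by positivity) (by norm_num)]
    linarith
  have hdiff : |√((N : ℝ) / M) * l2norm (A *ᵥ v) - √((N : ℝ) / M) * l2norm (A *ᵥ v')| ≤ ε / 4 := by
    rw [← mul_sub, abs_mul, abs_of_nonneg (Real.sqrt_nonneg _)]
    calc _ ≤ √((N : ℝ) / M) * l2norm (A *ᵥ v - A *ᵥ v') := by
          gcongr; exact abs_l2norm_sub_le _ _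
      _ ≤ √(N : ℝ) * l2norm (v - v') := by
          rw [← Matrix.mulVec_sub]; exact sqrt_mul_l2norm_mulVec_le hM hN hA _
      _ ≤ ε / 4 := hη1
  have hnorm := abs_le.mp (abs_l2norm_sub_le v v')
  rw [hv1] at hnorm
  have hz' := abs_le.mp (hgrid z hz)
  have hdiff' := abs_le.mp hdiff
  rw [hgoal]
  constructor <;> nlinarith

/-- The deterministic bound gives the upper estimate; the lower one is trivial because `ε ≥ √N ≥ 1`.
-/
theorem isIsometryOnSpan_of_sqrt_le {n : Type*} [Fintype n] (hM : 0 < M) (hN : 0 < N) {ε : ℝ}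
    (hεN : √(N : ℝ) ≤ ε) {A : Matrix (Fin M) (Fin N) ℂ} (hA : ∀ i j, ‖A i j‖ = 1 / √(N : ℝ))
    (T : Matrix (Fin N) n ℂ) : IsIsometryOnSpan ε A T := by
  intro q hq
  have hpos : 0 < l2norm (T *ᵥ q) :=
    (l2norm_nonneg _).lt_of_ne' fun h0 => hq (l2norm_eq_zero.mp h0)
  have h1 := sqrt_mul_l2norm_mulVec_le hM hN hA (T *ᵥ q)
  rw [← div_le_iff₀ hpos, ← mul_div_assoc'] at h1
  have h2 : 1 ≤ √(N : ℝ) := Real.one_le_sqrt.mpr (by exact_mod_cast hN)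
  have h3 : 0 ≤ √((N : ℝ) / M) * (l2norm (A *ᵥ (T *ᵥ q)) / l2norm (T *ᵥ q)) :=
    mul_nonneg (Real.sqrt_nonneg _) (div_nonneg (l2norm_nonneg _) (l2norm_nonneg _))
  constructor <;> linarith

theorem ae_norm_entry {Ω : Type*} [MeasurableSpace Ω] {P : Measure Ω}
    {A : Ω → Matrix (Fin M) (Fin N) ℂ} (hA : IsUniformMeasurementMatrix P A) :
    ∀ᵐ w ∂P, ∀ i j, ‖A w i j‖ = 1 / √(N : ℝ) := by
  rw [ae_all_iff]
  intro i
  rw [ae_all_iff]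
  intro j
  have h1 := ae_mem_weightValues N
  rw [← (hA.hasLaw i j).map_eq] at h1
  filter_upwards [ae_of_ae_map (hA.hasLaw i j).aemeasurable h1] with w hw
  exact norm_of_mem_weightValues hw

theorem measure_isometry_failure_le {Ω : Type*} [MeasurableSpace Ω] {P : Measure Ω}
    {A : Ω → Matrix (Fin M) (Fin N) ℂ} (hA : IsUniformMeasurementMatrix P A)
    (hN : 0 < N) (hM : 0 < M) (y : Fin N → ℂ) {t : ℝ} (ht : 0 < t) :
    P {w | ¬ |√((N : ℝ) / M) * l2norm (A w *ᵥ y) - l2norm y| ≤ t * l2norm y} ≤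
      ENNReal.ofReal (2 * Real.exp (-(t ^ 2 * M / 4096))) := by
  have hmeas : MeasurableSet {a : Fin M → Fin N → ℂ |
      ¬ |√((N : ℝ) / M) * l2norm (Matrix.of a *ᵥ y) - l2norm y| ≤ t * l2norm y} := by
    have : (fun a : Fin M → Fin N → ℂ => l2norm (Matrix.of a *ᵥ y)) =
        fun a => √(∑ m, ‖∑ n, a m n * y n‖ ^ 2) := by
      ext a
      rw [← Real.sqrt_sq (l2norm_nonneg _), l2norm_sq]
      rfl
    have hm : Measurable fun a : Fin M → Fin N → ℂ => l2norm (Matrix.of a *ᵥ y) := by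
      rw [this]
      fun_prop
    have hm' : Measurable fun a : Fin M → Fin N → ℂ =>
        |√((N : ℝ) / M) * l2norm (Matrix.of a *ᵥ y) - l2norm y| := by
      fun_prop
    exact (measurableSet_le hm' measurable_const).compl
  have h1 := (hasLaw_matrixLaw hA).measure_eq hmeas
  rw [show {w | ¬ |√((N : ℝ) / M) * l2norm (A w *ᵥ y) - l2norm y| ≤ t * l2norm y} = {w |
    ¬ |√((N : ℝ) / M) * l2norm (Matrix.of (Matrix.of.symm (A w)) *ᵥ y) - l2norm y| ≤
      t * l2norm y} from rfl, h1, ← ofReal_measureReal]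
  exact ENNReal.ofReal_le_ofReal (measureReal_isometry_failure_le hN hM y ht)

end Isometry

/-! ### Counting grid points against the exponent -/

section Entropy

/-- This absorbs numerical constants into powers of `L`, using `√2 ^ 18 = 2 ^ 9`. -/
theorem le_pow_of_sqrt_two_le {L : ℝ} (hL : √2 ≤ L) : 512 ≤ L ^ 18 := by
  have h := pow_le_pow_left₀ (Real.sqrt_nonneg 2) hL 18
  have h2 : (√2 : ℝ) ^ 18 = 512 := by
    rw [show (18 : ℕ) = 2 * 9 from rfl, pow_mul, Real.sq_sqrt (by norm_num)]
    norm_num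
  rwa [h2] at h

/-- The box of integers needed for a grid of mesh `ε δ / (12 K N²)` has polynomial size in
`N K / (ε δ)`. -/
theorem exists_box_bound {N K : ℕ} (hN : 2 ≤ N) (hK : 0 < K) {ε δ : ℝ} (hε : 0 < ε)
    (hεN : ε < √(N : ℝ)) (hδ : 0 < δ) (hδ1 : δ ≤ 1) :
    √2 ≤ N * K * ε⁻¹ * δ⁻¹ ∧
    ∃ B : ℕ, 4 * Real.pi / (ε * δ / (12 * K * N ^ 2)) + 1 ≤ B ∧
      δ⁻¹ / (ε * δ / (12 * K * N ^ 2)) + 1 ≤ B ∧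
      ((2 * B + 1 : ℕ) : ℝ) ≤ (N * K * ε⁻¹ * δ⁻¹) ^ 22 := by
  have hN2 : (2 : ℝ) ≤ N := by exact_mod_cast hN
  have hK1 : (1 : ℝ) ≤ K := by exact_mod_cast hK
  have hsN : √(N : ℝ) * √(N : ℝ) = N := Real.mul_self_sqrt (by linarith)
  have hs0 : 0 < √(N : ℝ) := Real.sqrt_pos.mpr (by linarith)
  have hδi : 1 ≤ δ⁻¹ := (one_le_inv₀ hδ).mpr hδ1
  set L : ℝ := N * K * ε⁻¹ * δ⁻¹ with hL
  have h1 : √(N : ℝ) ≤ N * ε⁻¹ := by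
    rw [← div_eq_mul_inv, le_div_iff₀ hε]
    nlinarith
  have h2 : √(N : ℝ) * δ⁻¹ ≤ L := by
    calc √(N : ℝ) * δ⁻¹ ≤ (N * ε⁻¹) * 1 * δ⁻¹ := by rw [mul_one]; gcongr
      _ ≤ (N * ε⁻¹) * K * δ⁻¹ := by gcongr
      _ = L := by rw [hL]; ring
  have hsL : √(N : ℝ) ≤ L := le_trans (le_mul_of_one_le_right hs0.le hδi) h2
  have h2L : √2 ≤ L := le_trans (Real.sqrt_le_sqrt hN2) hsL
  have hs1 : 1 ≤ √(N : ℝ) := Real.one_le_sqrt.mpr (by linarith)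
  have hL1 : 1 ≤ L := hs1.trans hsL
  have hNL : (N : ℝ) ≤ L ^ 2 := by rw [← hsN]; nlinarith
  have hδL : δ⁻¹ ≤ L := le_trans (le_mul_of_one_le_left (by linarith) hs1) h2
  have hρ : (ε * δ / (12 * K * N ^ 2))⁻¹ ≤ 12 * L ^ 3 := by
    have : (ε * δ / (12 * K * N ^ 2))⁻¹ = 12 * (N * L) := by
      rw [hL, inv_div, div_eq_mul_inv, mul_inv]; ring
    rw [this]
    have := mul_le_mul_of_nonneg_right hNL (zero_le_one.trans hL1)
    linarith
  have hL4 : L ^ 3 ≤ L ^ 4 := pow_le_pow_right₀ hL1 (by norm_num)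
  have hL41 : 1 ≤ L ^ 4 := one_le_pow₀ hL1
  -- Since `1/ρ ≤ 12 L³`, the frequencies need at most `13 · 12 L³ + 1` and the coefficients at most
  -- `12 L⁴ + 1`; `160 L⁴` covers both.
  refine ⟨h2L, ⌈160 * L ^ 4⌉₊, ?_, ?_, ?_⟩
  · refine le_trans ?_ (Nat.le_ceil _)
    rw [div_eq_mul_inv]
    have hpi := Real.pi_lt_d2
    have : 4 * Real.pi * (ε * δ / (12 * K * N ^ 2))⁻¹ ≤ 13 * (12 * L ^ 3) := by
      gcongr
      linarith
    linarith
  · refine le_trans ?_ (Nat.le_ceil _)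
    rw [div_eq_mul_inv]
    have : δ⁻¹ * (ε * δ / (12 * K * N ^ 2))⁻¹ ≤ L * (12 * L ^ 3) := by gcongr
    nlinarith
  · have h3 := Nat.ceil_lt_add_one (show 0 ≤ 160 * L ^ 4 by positivity)
    have h4 := le_pow_of_sqrt_two_le h2L
    push_cast
    calc 2 * ((⌈160 * L ^ 4⌉₊ : ℕ) : ℝ) + 1 ≤ 512 * L ^ 4 := by linarith
      _ ≤ L ^ 18 * L ^ 4 := by gcongr
      _ = L ^ 22 := by ring

/-- The Bernstein exponent at `t = ε/4` is `ε²M/65536`. Half of it remains as `c = 1/131072`; the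
other half beats the count `L^(112K)`, with the factor 2 included, because `14680064 = 112 ·
131072`. -/
theorem card_mul_exp_le {K M b : ℕ} (hK : 0 < K) {ε L : ℝ} (hε : 0 < ε)
    (hL : √2 ≤ L) (hb : (b : ℝ) ≤ L ^ 22)
    (hM : 14680064 * ε⁻¹ ^ 2 * K * Real.log L ≤ M) :
    (b : ℝ) ^ (K * 5) * (2 * Real.exp (-((ε / 4) ^ 2 * M / 4096))) ≤
      Real.exp (-(1 / 131072 * ε ^ 2 * M)) := by
  have hL0 : 0 < L := lt_of_lt_of_le (by positivity) hL
  have hL1 : 1 ≤ L := le_trans (Real.one_le_sqrt.mpr (by norm_num)) hL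
  have h2 : 2 ≤ L ^ 2 := by
    have := pow_le_pow_left₀ (Real.sqrt_nonneg 2) hL 2
    rwa [Real.sq_sqrt (by norm_num)] at this
  have hcard : (b : ℝ) ^ (K * 5) * 2 ≤ Real.exp (112 * K * Real.log L) := by
    calc (b : ℝ) ^ (K * 5) * 2 ≤ (L ^ 22) ^ (K * 5) * L ^ 2 := by gcongr
      _ = L ^ (110 * K + 2) := by rw [← pow_mul, ← pow_add]; congr 1; ring
      _ ≤ L ^ (112 * K) := pow_le_pow_right₀ hL1 (by omega)
      _ = Real.exp (112 * K * Real.log L) := by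
        rw [← Real.exp_log (pow_pos hL0 _), Real.log_pow]
        push_cast
        rfl
  have hM' : 14680064 * K * Real.log L ≤ ε ^ 2 * M := by
    have := mul_le_mul_of_nonneg_left hM (sq_nonneg ε)
    refine le_trans (le_of_eq ?_) this
    field_simp
  rw [← mul_assoc]
  calc _ ≤ Real.exp (112 * K * Real.log L) * Real.exp (-((ε / 4) ^ 2 * M / 4096)) := by gcongr
    _ ≤ _ := by
      rw [← Real.exp_add, Real.exp_le_exp]
      linarith

end Entropy

end SinusoidMixture

end

/-! ### The union bound -/

theorem theorem3 :
    ∃ C c : ℝ, 0 < C ∧ 0 < c ∧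
      ∀ (N K M : ℕ) (h : Fin N → ℂ) (ε δ : ℝ),
        0 < K → 0 < M →
        ∑ n, ‖h n‖ ^ 2 = 1 → (∃ i j, i ≠ j ∧ h i ≠ 0 ∧ h j ≠ 0) →
        0 < ε → 0 < δ →
        C * ε⁻¹ ^ 2 * K * Real.log (N * K * ε⁻¹ * δ⁻¹) ≤ M →
        ∀ (Ω : Type*) [MeasurableSpace Ω] (P : Measure Ω) [IsProbabilityMeasure P]
          (A : Ω → Matrix (Fin M) (Fin N) ℂ),
          SinusoidMixture.IsUniformMeasurementMatrix P A →
          P {w | ¬ ∀ ω ∈ SinusoidMixture.wellConditioned h K δ,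
              SinusoidMixture.IsIsometryOnSpan ε (A w) (SinusoidMixture.tangentMatrix h ω)} ≤
            ENNReal.ofReal (Real.exp (-(c * ε ^ 2 * M))) := by
  open SinusoidMixture in
  refine ⟨14680064, 1 / 131072, by norm_num, by norm_num, ?_⟩
  intro N K M h ε δ hK hM hh ⟨i, j, hij, _, _⟩ hε hδ hCM Ω _ P _ A hA
  -- With `ε < √N` and `δ ≤ 1`, this keeps `L ≥ √2`, so the logarithm is bounded away from zero.
  have hN2 : 2 ≤ N := by
    have := i.2
    have := j.2
    have : (i : ℕ) ≠ j := fun h => hij (Fin.ext h)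
    omega
  have hN : 0 < N := by omega
  have hh1 : l2norm h = 1 := by
    rw [← Real.sqrt_sq (l2norm_nonneg h), l2norm_sq, hh, Real.sqrt_one]
  have hae := ae_norm_entry hA
  by_cases hδ1 : δ ≤ 1
  swap
  · have hempty : wellConditioned h K δ = ∅ :=
      Set.eq_empty_of_forall_notMem fun ω hω => hδ1 (le_one_of_mem_wellConditioned hK hh1 hω)
    simp [hempty]
  by_cases hεN : ε < √(N : ℝ)
  swap
  · have hnull : ∀ᵐ w ∂P, ∀ ω ∈ wellConditioned h K δ,
        IsIsometryOnSpan ε (A w) (tangentMatrix h ω) := by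
      filter_upwards [hae] with w hw ω _
      exact isIsometryOnSpan_of_sqrt_le hM hN (not_lt.mp hεN) hw _
    rw [ae_iff.mp hnull]
    exact zero_le
  obtain ⟨hL, B, hB1, hB2, hB⟩ := exists_box_bound hN2 hK hε hεN hδ hδ1
  set ρ : ℝ := ε * δ / (12 * K * N ^ 2) with hρ
  have hN2' : (2 : ℝ) ≤ N := by exact_mod_cast hN2
  have hK' : (0 : ℝ) < K := by exact_mod_cast hK
  have hρ0 : 0 < ρ := by positivity
  have hδi : 1 ≤ δ⁻¹ := (one_le_inv₀ hδ).mpr hδ1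
  have hmesh : K * (ρ * (N * δ⁻¹ + 4)) ≤ ε / (4 * N) := by
    -- Here `4 ≤ 2 N δ⁻¹`; the resulting factor 3 explains the 12 in `ρ`.
    calc K * (ρ * (N * δ⁻¹ + 4)) ≤ K * (ρ * (3 * (N * δ⁻¹))) := by
          gcongr
          nlinarith
      _ = ε / (4 * N) := by
          rw [hρ]
          field_simp
          norm_num
  set S := Fintype.piFinset (fun _ : Fin K × Fin 5 => Finset.Icc (-(B : ℤ)) B)
  set bad : (Fin K × Fin 5 → ℤ) → Set Ω := fun z =>
    {w | ¬ |√((N : ℝ) / M) * l2norm (A w *ᵥ gridPoint h (tangentWeights h) ρ z) -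
        l2norm (gridPoint h (tangentWeights h) ρ z)| ≤
          ε / 4 * l2norm (gridPoint h (tangentWeights h) ρ z)}
  have hcard : S.card = (2 * B + 1) ^ (K * 5) := by
    rw [Fintype.card_piFinset, Finset.prod_const, Finset.card_univ, Int.card_Icc, Fintype.card_prod, Fintype.card_fin,
      Fintype.card_fin]
    congr 1
    omega
  calc P _ ≤ P (⋃ z ∈ S, bad z) := by
        -- The inclusion holds only almost everywhere, since the entries have modulus `1/√N` only
        -- almost surely.
        refine measure_mono_ae ?_
        filter_upwards [hae] with w hw hfail
        by_contra hnot
        refine hfail fun ω hω => isIsometryOnSpan_of_grid hM hN hh1 hδ hρ0 hε hεN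
          (B := B) (by exact_mod_cast hB1) (by exact_mod_cast hB2) hmesh hw (fun z hz => ?_) hω
        by_contra hz'
        exact hnot (Set.mem_biUnion hz hz')
    _ ≤ ∑ z ∈ S, P (bad z) := measure_biUnion_finset_le _ _
    _ ≤ ∑ _z ∈ S, ENNReal.ofReal (2 * Real.exp (-((ε / 4) ^ 2 * M / 4096))) :=
        Finset.sum_le_sum fun z _ => measure_isometry_failure_le hA hN hM _ (by positivity)
    _ = ENNReal.ofReal (((2 * B + 1 : ℕ) : ℝ) ^ (K * 5) *
          (2 * Real.exp (-((ε / 4) ^ 2 * M / 4096)))) := by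
        rw [Finset.sum_const, hcard, nsmul_eq_mul, ← Nat.cast_pow,
          ENNReal.ofReal_mul (Nat.cast_nonneg _), ENNReal.ofReal_natCast]
    _ ≤ _ := ENNReal.ofReal_le_ofReal (card_mul_exp_le hK hε hL hB hCM)
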